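/- Let $R$ be an associative ring with $1$; modules are unitary left $R$-modules, viewed as first-order structures in the language with symbols $0,+,-$ and one unary function symbol for each $r\in R$. A unary pp formula is a formula $\varphi(x)$ of the form $\exists y_1\cdots y_k\,(A\bar y=\mathbf b\,x)$ with $A$ an $m\times k$ matrix and $\mathbf b$ an $m\times 1$ column over $R$; it defines a subgroup $\varphi(M)$ of every module $M$, and it is called high if $\varphi(E)=E$ for every injective module $E$. The first Ulm submodule $\mathfrak u(M)$ of a module $M$ is the intersection of the subgroups $\varphi(M)$ over all high formulas $\varphi$. The Ulm sequence of $M$ is defined by $\mathfrak u^0(M)=M$, $\mathfrak u^{\alpha+1}(M)=\mathfrak u(\mathfrak u^\alpha(M))$ and $\mathfrak u^\delta(M)=\bigcap_{\alpha<\delta}\mathfrak u^\alpha(M)$ for limit ordinals $\delta$, and the Ulm length of $M$ is the smallest ordinal $\tau$ with $\mathfrak u^{\tau+1}(M)=\mathfrak u^\tau(M)$. Corollary. Every module $M$ is elementarily equivalent to a module $N$ of Ulm length at most $1$; in fact, $N$ can be chosen so that $M$ is (isomorphic to) an elementary submodule of $N$. -/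

import Mathlib

open FirstOrder

universe u v w

/-! ### The first-order language of left modules over a ring -/

/-- Function symbols of the language of left `R`-modules: `0`, `-`, `+`, and one unary function
symbol for every scalar `r : R`. -/
inductive ModuleFunc (R : Type u) : ℕ → Type u
  | zero : ModuleFunc R 0
  | neg : ModuleFunc R 1
  | add : ModuleFunc R 2
  | smul (r : R) : ModuleFunc R 1

/-- The language of left `R`-modules (there are no relation symbols besides equality). -/
def moduleLanguage (R : Type u) : FirstOrder.Language.{u, 0} where
  Functions := ModuleFunc R
  Relations := fun _ => Empty

/-- Every left `R`-module, as a first-order structure for the language of left `R`-modules. -/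
instance moduleStructure (R : Type u) [Ring R] (M : Type v) [AddCommGroup M] [Module R M] :
    (moduleLanguage R).Structure M where
  funMap := fun {_} f =>
    match f with
    | ModuleFunc.zero => fun _ => 0
    | ModuleFunc.neg => fun x => -x 0
    | ModuleFunc.add => fun x => x 0 + x 1
    | ModuleFunc.smul r => fun x => r • x 0
  RelMap := fun {_} r => Empty.elim r

/-- `S` is an elementary submodule of `N`: the inclusion of the submodule `S`, with its own module
structure, into `N` is an elementary embedding. -/
def Submodule.IsElementary {R : Type u} [Ring R] {N : Type v} [AddCommGroup N] [Module R N]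
    (S : Submodule R N) : Prop :=
  ∃ f : S ↪ₑ[moduleLanguage R] N, ∀ x : S, f x = (x : N)

/-! ### Unary positive primitive formulas and high formulas -/

/-- A unary pp formula `∃ y₁ … yₖ, A y = b x` in the language of left `R`-modules, where `A` is an
`m × k` matrix and `b` an `m × 1` column over `R`. -/
structure UnaryPP (R : Type u) where
  m : ℕ
  k : ℕ
  A : Matrix (Fin m) (Fin k) R
  b : Fin m → R

namespace UnaryPP

variable {R : Type u} [Ring R]

/-- The subgroup `φ(M)` of `M` that is defined by the unary pp formula `φ`. -/
def eval (φ : UnaryPP R) (M : Type v) [AddCommGroup M] [Module R M] : AddSubgroup M where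
  carrier := {x | ∃ y : Fin φ.k → M, ∀ i, ∑ j, φ.A i j • y j = φ.b i • x}
  zero_mem' := ⟨0, fun i => by simp⟩
  add_mem' := by
    rintro x x' ⟨y, hy⟩ ⟨y', hy'⟩
    exact ⟨y + y', fun i => by simp [smul_add, Finset.sum_add_distrib, hy i, hy' i]⟩
  neg_mem' := by
    rintro x ⟨y, hy⟩
    exact ⟨-y, fun i => by simp [hy i]⟩

theorem mem_eval {φ : UnaryPP R} {M : Type v} [AddCommGroup M] [Module R M] {x : M} :
    x ∈ φ.eval M ↔ ∃ y : Fin φ.k → M, ∀ i, ∑ j, φ.A i j • y j = φ.b i • x := Iff.rfl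

/-- `φ` is high: `φ(N) = N` for every injective left `R`-module `N`. (The injective hull of `R`, for
which it suffices to test this, lives in the universe of `R`.) -/
def IsHigh (φ : UnaryPP R) : Prop :=
  ∀ (N : Type u) [AddCommGroup N] [Module R N], Module.Injective R N → φ.eval N = ⊤

/-- The formula `φ(r x)`. -/
def preimage (r : R) (φ : UnaryPP R) : UnaryPP R where
  m := φ.m
  k := φ.k
  A := φ.A
  b := fun i => φ.b i * r

theorem mem_preimage_eval {r : R} {φ : UnaryPP R} {M : Type v} [AddCommGroup M] [Module R M]
    {x : M} : x ∈ (φ.preimage r).eval M ↔ r • x ∈ φ.eval M := by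
  simp [mem_eval, preimage, mul_smul]

theorem IsHigh.preimage {φ : UnaryPP R} (h : φ.IsHigh) (r : R) : (φ.preimage r).IsHigh := by
  intro N _ _ hN
  ext x
  simp [mem_preimage_eval, h N hN]

end UnaryPP

/-! ### Ulm submodules, the Ulm sequence and the Ulm length -/

section Ulm

variable (R : Type u) [Ring R] (M : Type v) [AddCommGroup M] [Module R M]

/-- The first Ulm submodule of `M`: the intersection of all subgroups of `M` that are defined by
high formulas. -/
def ulm : Submodule R M where
  carrier := {x | ∀ φ : UnaryPP R, φ.IsHigh → x ∈ φ.eval M}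
  zero_mem' := fun φ _ => zero_mem (φ.eval M)
  add_mem' := fun hx hy φ h => add_mem (hx φ h) (hy φ h)
  smul_mem' := fun r _ hx φ h => UnaryPP.mem_preimage_eval.1 (hx (φ.preimage r) (h.preimage r))

/-- The Ulm sequence of `M`, as a sequence of submodules of `M`: `u⁰(M) = M`,
`u^(α+1)(M) = u(u^α(M))`, and `u^δ(M) = ⋂_{α < δ} u^α(M)` for limit ordinals `δ`. -/
noncomputable def ulmSeq (α : Ordinal.{w}) : Submodule R M :=
  Ordinal.limitRecOn α ⊤ (fun _ U => (ulm R U).map U.subtype)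
    (fun δ _ U => ⨅ (β : Ordinal.{w}) (h : β < δ), U β h)

/-- The Ulm length of `M`: the smallest ordinal `τ` such that `u^(τ+1)(M) = u^τ(M)`. -/
noncomputable def ulmLength : Ordinal.{v} :=
  sInf {τ : Ordinal.{v} | ulmSeq R M (τ + 1) = ulmSeq R M τ}

theorem ulmSeq_zero : ulmSeq R M (0 : Ordinal.{w}) = ⊤ :=
  Ordinal.limitRecOn_zero _ _ _

theorem ulmSeq_add_one (α : Ordinal.{w}) :
    ulmSeq R M (α + 1) = (ulm R (ulmSeq R M α)).map (ulmSeq R M α).subtype :=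
  Ordinal.limitRecOn_add_one _ _ _ _

theorem ulmSeq_limit (δ : Ordinal.{w}) (hδ : Order.IsSuccLimit δ) :
    ulmSeq R M δ = ⨅ (β : Ordinal.{w}) (_ : β < δ), ulmSeq R M β :=
  Ordinal.limitRecOn_limit _ _ _ _ hδ

theorem ulmSeq_antitone : Antitone (ulmSeq.{u, v, w} R M) := by
  intro α β h
  induction β using Ordinal.limitRecOn with
  | zero => rw [nonpos_iff_eq_zero.1 h]
  | add_one β ih =>
    rcases h.lt_or_eq with h | rfl
    · rw [ulmSeq_add_one]
      exact (Submodule.map_subtype_le _ _).trans (ih (Order.lt_add_one_iff.1 h))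
    · exact le_rfl
  | limit δ hδ _ =>
    rcases h.lt_or_eq with h | rfl
    · rw [ulmSeq_limit R M δ hδ]
      exact iInf₂_le α h
    · exact le_rfl

/-- The Ulm sequence becomes stationary, so that the Ulm length is well defined. -/
theorem ulmSeq_ulmLength : ulmSeq R M (ulmLength R M + 1) = ulmSeq R M (ulmLength R M) := by
  refine csInf_mem (s := {τ : Ordinal.{v} | ulmSeq R M (τ + 1) = ulmSeq R M τ}) ?_
  by_contra hne
  refine not_injective_of_ordinal (ulmSeq.{u, v, v} R M) (StrictAnti.injective ?_)
  intro α β h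
  refine lt_of_le_of_lt (ulmSeq_antitone R M (Order.add_one_le_of_lt h)) ?_
  refine lt_of_le_of_ne (ulmSeq_antitone R M (Order.le_succ α)) ?_
  exact fun e => hne ⟨α, e⟩

end Ulm

/-! Let `x` lie in the first Ulm submodule of `M` and let `φ` be high. For a finite set `F` of high
formulas, the formula saying that `φ` has witnesses which all satisfy `F` is again high
(`UnaryPP.IsHigh.relativize`), so `x` has such witnesses in `M`. Take an ultrapower indexed by these
`F`, along an ultrafilter containing every upward cone. The class of the witnesses chosen for each
`F` satisfies every high formula, so the image of `x` has witnesses for `φ` in the first Ulm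
submodule of the ultrapower (`exists_witness_mem_ulm_ultrapower`).

Iterate `ω` times and let `N` be the union. The stages are pure in `N`, so an element of `ulm R N`
lies in `ulm` of some stage. Its witnesses lie in `ulm` of the next stage, hence in `ulm R N`. Thus
`ulm R N` is its own first Ulm submodule. By Łoś's theorem and Tarski's theorem on elementary
chains, `M` embeds elementarily in `N`. -/

open Filter

/-! ### Positive primitive formulas -/

namespace UnaryPP

variable {R : Type u} [Ring R]

theorem map_mem_eval {M : Type v} [AddCommGroup M] [Module R M] {N : Type w} [AddCommGroup N]
    [Module R N] (f : M →ₗ[R] N) {φ : UnaryPP R} {x : M} (hx : x ∈ φ.eval M) :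
    f x ∈ φ.eval N := by
  obtain ⟨y, hy⟩ := hx
  refine ⟨fun j => f (y j), fun i => ?_⟩
  simpa using congrArg f (hy i)

/-- The unary pp formula of a linear system indexed by arbitrary finite types. -/
noncomputable def ofFintype {μ κ : Type*} [Fintype μ] [Fintype κ] (A : Matrix μ κ R) (b : μ → R) :
    UnaryPP R where
  m := Fintype.card μ
  k := Fintype.card κ
  A := fun i j => A ((Fintype.equivFin μ).symm i) ((Fintype.equivFin κ).symm j)
  b := fun i => b ((Fintype.equivFin μ).symm i)

theorem mem_ofFintype_eval {μ κ : Type*} [Fintype μ] [Fintype κ] {A : Matrix μ κ R} {b : μ → R}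
    {M : Type v} [AddCommGroup M] [Module R M] {x : M} :
    x ∈ (ofFintype A b).eval M ↔ ∃ y : κ → M, ∀ i, ∑ j, A i j • y j = b i • x := by
  rw [mem_eval]
  constructor
  · rintro ⟨y, hy⟩
    refine ⟨fun j => y (Fintype.equivFin κ j), fun i => ?_⟩
    have h := hy (Fintype.equivFin μ i)
    simp only [ofFintype, Equiv.symm_apply_apply] at h
    rw [← h]
    exact Fintype.sum_equiv (Fintype.equivFin κ) _ _ fun j => by simp
  · rintro ⟨y, hy⟩
    refine ⟨fun j => y ((Fintype.equivFin κ).symm j), fun i => ?_⟩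
    refine Eq.trans ?_ (hy ((Fintype.equivFin μ).symm i))
    exact Fintype.sum_equiv (Fintype.equivFin κ).symm _ _ fun j => by simp [ofFintype]

open Classical in
/-- The formula `∃ y, A y = b x ∧ ⋀_{ψ ∈ F} ⋀_j ψ(y j)`, where `φ` is `∃ y, A y = b x`. -/
noncomputable def relativize (φ : UnaryPP R) (F : Finset (UnaryPP R)) : UnaryPP R :=
  ofFintype (μ := Fin φ.m ⊕ Σ p : F × Fin φ.k, Fin p.1.1.m)
    (κ := Fin φ.k ⊕ Σ p : F × Fin φ.k, Fin p.1.1.k)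
    (Sum.elim (fun i => Sum.elim (fun j => φ.A i j) fun _ => 0)
      -- Each pair `(ψ, j)` gets its own copy of the system of `ψ`, with fresh unknowns. The term
      -- `ψ.b • y j` is moved to the left, so these rows have right-hand side `0`.
      fun q => Sum.elim (fun j => if j = q.1.2 then -q.1.1.1.b q.2 else 0)
        fun r => if h : q.1 = r.1 then q.1.1.1.A q.2 (h ▸ r.2) else 0)
    (Sum.elim φ.b fun _ => 0)

open Classical in
theorem mem_relativize_eval {φ : UnaryPP R} {F : Finset (UnaryPP R)} {M : Type v}
    [AddCommGroup M] [Module R M] {x : M} :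
    x ∈ (φ.relativize F).eval M ↔ ∃ y : Fin φ.k → M,
      (∀ i, ∑ j, φ.A i j • y j = φ.b i • x) ∧ ∀ ψ ∈ F, ∀ j, y j ∈ ψ.eval M := by
  have key : ∀ (y : Fin φ.k → M) (z : (Σ p : F × Fin φ.k, Fin p.1.1.k) → M)
      (p : F × Fin φ.k) (i : Fin p.1.1.m),
      (∑ j, (if j = p.2 then -p.1.1.b i else 0) • y j +
        ∑ r : (Σ p : F × Fin φ.k, Fin p.1.1.k),
          (if h : p = r.1 then p.1.1.A i (h ▸ r.2) else 0) • z r = (0 : R) • x) ↔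
      ∑ l, p.1.1.A i l • z ⟨p, l⟩ = p.1.1.b i • y p.2 := by
    intro y z p i
    have h1 : ∑ j, (if j = p.2 then -p.1.1.b i else 0) • y j = -(p.1.1.b i • y p.2) := by
      simp [ite_smul]
    have h2 : ∑ r : (Σ p : F × Fin φ.k, Fin p.1.1.k),
          (if h : p = r.1 then p.1.1.A i (h ▸ r.2) else 0) • z r =
        ∑ l, p.1.1.A i l • z ⟨p, l⟩ := by
      rw [Fintype.sum_sigma, Finset.sum_eq_single p]
      · simp
      · intro q _ hq
        exact Finset.sum_eq_zero fun l _ => by rw [dif_neg (Ne.symm hq), zero_smul]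
      · simp
    rw [h1, h2, zero_smul, neg_add_eq_zero, eq_comm]
  refine mem_ofFintype_eval.trans ?_
  constructor
  · rintro ⟨y, hy⟩
    refine ⟨fun j => y (Sum.inl j), fun i => ?_, fun ψ hψ j => ?_⟩
    · simpa using hy (Sum.inl i)
    · refine ⟨fun l => y (Sum.inr ⟨(⟨ψ, hψ⟩, j), l⟩), fun i => ?_⟩
      have h := hy (Sum.inr ⟨(⟨ψ, hψ⟩, j), i⟩)
      rw [Fintype.sum_sum_type] at h
      exact (key (fun j => y (Sum.inl j)) (fun r => y (Sum.inr r)) (⟨ψ, hψ⟩, j) i).1 h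
  · rintro ⟨y, hy, hF⟩
    choose z hz using hF
    refine ⟨Sum.elim y fun r => z r.1.1.1 r.1.1.2 r.1.2 r.2, ?_⟩
    rintro (i | ⟨p, i⟩)
    · simpa using hy i
    · rw [Fintype.sum_sum_type]
      exact (key y (fun r => z r.1.1.1 r.1.1.2 r.1.2 r.2) p i).2 (hz p.1.1 p.1.2 p.2 i)

/-- In an injective module the added conditions hold for every tuple, so any witnesses for `φ` will
do. -/
theorem IsHigh.relativize {φ : UnaryPP R} (hφ : φ.IsHigh) {F : Finset (UnaryPP R)}
    (hF : ∀ ψ ∈ F, ψ.IsHigh) : (φ.relativize F).IsHigh := by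
  intro N _ _ hN
  rw [eq_top_iff]
  intro x _
  obtain ⟨y, hy⟩ : x ∈ φ.eval N := by rw [hφ N hN]; trivial
  exact mem_relativize_eval.2 ⟨y, hy, fun ψ hψ j => by rw [hF ψ hψ N hN]; trivial⟩

end UnaryPP

/-! ### Linear maps and module structures -/

section LinearMaps

variable {R : Type u} [Ring R]

/-- A linear map, as a homomorphism of first-order structures. -/
def LinearMap.toLanguageHom {M : Type v} [AddCommGroup M] [Module R M] {N : Type w}
    [AddCommGroup N] [Module R N] (f : M →ₗ[R] N) : M →[moduleLanguage R] N where
  toFun := f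
  map_fun' := by
    rintro n (_ | _ | _ | r) x
    · exact map_zero f
    · exact map_neg f _
    · exact map_add f _ _
    · exact map_smul f r _
  map_rel' := fun r => Empty.elim r

/-- A linear equivalence, as an equivalence of first-order structures. -/
def LinearEquiv.toLanguageEquiv {M : Type v} [AddCommGroup M] [Module R M] {N : Type w}
    [AddCommGroup N] [Module R N] (e : M ≃ₗ[R] N) : M ≃[moduleLanguage R] N where
  toEquiv := e.toEquiv
  map_fun' := fun f x => e.toLinearMap.toLanguageHom.map_fun' f x
  map_rel' := fun r => Empty.elim r

/-- A linear map is elementary if it is an elementary embedding of first-order structures. -/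
def LinearMap.IsElementary {M : Type v} [AddCommGroup M] [Module R M] {N : Type w}
    [AddCommGroup N] [Module R N] (f : M →ₗ[R] N) : Prop :=
  ∃ g : M ↪ₑ[moduleLanguage R] N, ⇑g = f

/-- A linear map is pure if it reflects pp formulas. -/
def LinearMap.IsPure {M : Type v} [AddCommGroup M] [Module R M] {N : Type w}
    [AddCommGroup N] [Module R N] (f : M →ₗ[R] N) : Prop :=
  ∀ (φ : UnaryPP R) (x : M), f x ∈ φ.eval N → x ∈ φ.eval M

theorem LinearMap.IsElementary.comp {M : Type*} [AddCommGroup M] [Module R M] {N : Type*}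
    [AddCommGroup N] [Module R N] {P : Type*} [AddCommGroup P] [Module R P] {g : N →ₗ[R] P}
    {f : M →ₗ[R] N} (hg : g.IsElementary) (hf : f.IsElementary) : (g ∘ₗ f).IsElementary := by
  obtain ⟨g', hg'⟩ := hg
  obtain ⟨f', hf'⟩ := hf
  exact ⟨g'.comp f', by ext x; simp [← hg', ← hf']⟩

theorem LinearEquiv.isElementary {M : Type*} [AddCommGroup M] [Module R M] {N : Type*}
    [AddCommGroup N] [Module R N] (e : M ≃ₗ[R] N) : e.toLinearMap.IsElementary :=
  ⟨e.toLanguageEquiv.toElementaryEmbedding, rfl⟩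

theorem LinearMap.IsElementary.injective {M : Type*} [AddCommGroup M] [Module R M] {N : Type*}
    [AddCommGroup N] [Module R N] {f : M →ₗ[R] N} (hf : f.IsElementary) :
    Function.Injective f := by
  obtain ⟨f', hf'⟩ := hf
  exact hf' ▸ f'.injective

theorem LinearMap.map_mem_ulm {M : Type*} [AddCommGroup M] [Module R M] {N : Type*}
    [AddCommGroup N] [Module R N] (f : M →ₗ[R] N) {x : M} (hx : x ∈ ulm R M) :
    f x ∈ ulm R N :=
  fun φ hφ => UnaryPP.map_mem_eval f (hx φ hφ)

end LinearMaps

/-! ### Ultrapowers -/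

section Ultrapower

variable {R : Type u} [Ring R] {M : Type v} [AddCommGroup M] [Module R M] {I : Type w}

/-- The diagonal map into a reduced power. -/
def Filter.Germ.diagonal (R : Type u) [Ring R] (M : Type v) [AddCommGroup M] [Module R M]
    (l : Filter I) : M →ₗ[R] Germ l M where
  toFun := fun x => (x : Germ l M)
  map_add' := fun _ _ => rfl
  map_smul' := fun _ _ => rfl

theorem Filter.Germ.mem_eval {l : Filter I} {φ : UnaryPP R} {x : I → M}
    (h : ∀ᶠ a in l, x a ∈ φ.eval M) : (x : Germ l M) ∈ φ.eval (Germ l M) := by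
  classical
  -- The value `0` at bad indices only makes the choice total; the germ ignores it.
  have h' : ∀ a, ∃ y : Fin φ.k → M, x a ∈ φ.eval M → ∀ i, ∑ j, φ.A i j • y j = φ.b i • x a := by
    intro a
    by_cases ha : x a ∈ φ.eval M
    · obtain ⟨y, hy⟩ := ha
      exact ⟨y, fun _ => hy⟩
    · exact ⟨0, fun h => absurd h ha⟩
  choose y hy using h'
  refine ⟨fun j => ((fun a => y a j : I → M) : Germ l M), fun i => ?_⟩
  have hsum : ∑ j, φ.A i j • ((fun a => y a j : I → M) : Germ l M) =
      ((∑ j, φ.A i j • (fun a => y a j) : I → M) : Germ l M) :=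
    (map_sum (Germ.coeAddHom l) (fun j => φ.A i j • (fun a => y a j : I → M)) Finset.univ).symm
  rw [hsum, ← Germ.coe_smul, Germ.coe_eq]
  filter_upwards [h] with a ha
  simpa using hy a ha i

theorem Filter.Germ.eventually_mem_eval {l : Filter I} {φ : UnaryPP R} {x : I → M}
    (h : (x : Germ l M) ∈ φ.eval (Germ l M)) : ∀ᶠ a in l, x a ∈ φ.eval M := by
  obtain ⟨y, hy⟩ := h
  have h' : ∀ j, ∃ z : I → M, (z : Germ l M) = y j := fun j => Quotient.exists_rep (y j)
  choose z hz using h'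
  have hsum : ∀ i, ∀ᶠ a in l, ∑ j, φ.A i j • z j a = φ.b i • x a := by
    intro i
    have hsum : ∑ j, φ.A i j • y j = ((∑ j, φ.A i j • z j : I → M) : Germ l M) := by
      simp only [← hz]
      exact (map_sum (Germ.coeAddHom l) (fun j => φ.A i j • z j) Finset.univ).symm
    have h := hy i
    rw [hsum, ← Germ.coe_smul, Germ.coe_eq] at h
    filter_upwards [h] with a ha
    simpa using ha
  filter_upwards [eventually_all.2 hsum] with a ha
  exact ⟨fun j => z j a, ha⟩

/-- Purity is proved apart from elementarity because a `UnaryPP` is a linear system, not a formula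
of `moduleLanguage R`. -/
theorem Filter.Germ.isPure_diagonal (l : Filter I) [l.NeBot] : (diagonal R M l).IsPure := by
  intro φ x hx
  obtain ⟨_, ha⟩ := (Germ.eventually_mem_eval (x := fun _ => x) hx).exists
  exact ha

theorem Filter.Germ.term_realize (l : Filter I) {α : Type*} (t : (moduleLanguage R).Term α)
    (x : α → I → M) :
    t.realize (fun i => (x i : Germ l M)) =
      ((fun a => t.realize fun i => x i a : I → M) : Germ l M) := by
  induction t with
  | var => rfl
  | func f ts ih =>
    simp only [FirstOrder.Language.Term.realize, ih]
    rcases f with _ | _ | _ | r <;> rfl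

/-- Łoś's theorem for ultrapowers of modules. -/
theorem Filter.Germ.boundedFormula_realize (U : Ultrafilter I) {α : Type*} {n : ℕ}
    (φ : (moduleLanguage R).BoundedFormula α n) (x : α → I → M) (v : Fin n → I → M) :
    φ.Realize (fun i => (x i : Germ (U : Filter I) M)) (fun i => (v i : Germ (U : Filter I) M)) ↔
      ∀ᶠ a in (U : Filter I), φ.Realize (fun i => x i a) fun i => v i a := by
  induction φ with
  | falsum => simp only [FirstOrder.Language.BoundedFormula.Realize, eventually_const]
  | equal t₁ t₂ =>
    have h1 : ∀ a, Sum.elim (fun i => x i a) (fun i => v i a) = fun i => Sum.elim x v i a :=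
      fun a => funext fun i => Sum.casesOn i (fun i => rfl) fun i => rfl
    have h2 : Sum.elim (fun i => (x i : Germ (U : Filter I) M))
        (fun i => (v i : Germ (U : Filter I) M)) =
        fun i => ((Sum.elim x v i : I → M) : Germ (U : Filter I) M) :=
      funext (by rintro (i | i) <;> rfl)
    simp only [FirstOrder.Language.BoundedFormula.Realize, h1, h2, Germ.term_realize, Germ.coe_eq]
    rfl
  | rel r => exact Empty.elim r
  | imp _ _ ih ih' =>
    simp only [FirstOrder.Language.BoundedFormula.Realize, ih v, ih' v]
    rw [Ultrafilter.eventually_imp]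
  | @all k φ ih =>
    have h1 : ∀ m : I → M, (Fin.snoc (fun i => (v i : Germ (U : Filter I) M))
        (m : Germ (U : Filter I) M) :
        Fin (k + 1) → Germ (U : Filter I) M) =
        fun i => ((Fin.snoc v m : Fin (k + 1) → I → M) i : Germ (U : Filter I) M) := fun m =>
      (Fin.comp_snoc (fun z : I → M => (z : Germ (U : Filter I) M)) v m).symm
    have h2 : ∀ (m : I → M) (a : I), (fun i => (Fin.snoc v m : Fin (k + 1) → I → M) i a) =
        (Fin.snoc (fun i => v i a) (m a) : Fin (k + 1) → M) := fun m a =>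
      Fin.comp_snoc (fun z : I → M => z a) v m
    simp only [FirstOrder.Language.BoundedFormula.Realize]
    have h3 : ∀ m : I → M, φ.Realize (fun i => (x i : Germ (U : Filter I) M))
        (Fin.snoc (fun i => (v i : Germ (U : Filter I) M)) (m : Germ (U : Filter I) M)) ↔
        ∀ᶠ a in (U : Filter I), φ.Realize (fun i => x i a) (Fin.snoc (fun i => v i a) (m a)) := by
      intro m
      rw [h1, ih]
      simp only [h2]
    constructor
    · intro h
      by_contra hne
      rw [← Ultrafilter.eventually_not] at hne
      -- A counterexample is picked wherever there is one; the germ of these choices contradicts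
      -- `h`.
      have hex : ∀ a, ∃ m : M, (¬ ∀ m, φ.Realize (fun i => x i a) (Fin.snoc (fun i => v i a) m)) →
          ¬ φ.Realize (fun i => x i a) (Fin.snoc (fun i => v i a) m) := by
        intro a
        by_cases ha : ∀ m, φ.Realize (fun i => x i a) (Fin.snoc (fun i => v i a) m)
        · exact ⟨0, fun h => absurd ha h⟩
        · obtain ⟨m, hm⟩ := not_forall.1 ha
          exact ⟨m, fun _ => hm⟩
      choose m hm using hex
      obtain ⟨a, ha, ha'⟩ := (((h3 m).1 (h m)).and hne).exists
      exact hm a ha' ha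
    · intro h m
      induction m using Germ.inductionOn with
      | h m =>
        refine (h3 m).2 ?_
        filter_upwards [h] with a ha
        exact ha (m a)

theorem Filter.Germ.isElementary_diagonal (U : Ultrafilter I) :
    (diagonal R M (U : Filter I)).IsElementary := by
  refine ⟨⟨diagonal R M (U : Filter I), fun n φ x => ?_⟩, rfl⟩
  have h := Germ.boundedFormula_realize U φ (fun i _ => x i) (fun i _ => (default : Fin 0 → M) i)
  rw [eventually_const] at h
  unfold FirstOrder.Language.Formula.Realize
  convert h using 2
  rfl

end Ultrapower

/-! ### Unions of elementary chains -/

section Chain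

variable {R : Type u} [Ring R] {ι : Type w} [Preorder ι] [IsDirectedOrder ι]
  [DecidableEq ι] {G : ι → Type v} [∀ i, AddCommGroup (G i)] [∀ i, Module R (G i)]
  {f : ∀ i j, i ≤ j → G i →ₗ[R] G j} [DirectedSystem G (f · · ·)]

theorem Module.DirectLimit.of_injective_of_injective
    (hf : ∀ i j h, Function.Injective (f i j h)) (i : ι) :
    Function.Injective (Module.DirectLimit.of R ι G f i) := by
  rw [injective_iff_map_eq_zero]
  intro x hx
  obtain ⟨j, hij, hj⟩ := Module.DirectLimit.of.zero_exact hx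
  exact (injective_iff_map_eq_zero _).1 (hf i j hij) x hj

variable [Nonempty ι]

/-- Tarski's union theorem, by induction on formulas. -/
theorem Module.DirectLimit.isElementary_of (hf : ∀ i j h, (f i j h).IsElementary) (i : ι) :
    (Module.DirectLimit.of R ι G f i).IsElementary := by
  have hinj := Module.DirectLimit.of_injective_of_injective fun i j h => (hf i j h).injective
  -- The stage `i` stays universally quantified: for `∀`, an element of the limit may appear only at
  -- a later stage `k`, where the induction hypothesis is then used.
  have key : ∀ {α : Type} {n : ℕ} (φ : (moduleLanguage R).BoundedFormula α n) (i : ι)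
      (v : α → G i) (x : Fin n → G i),
      φ.Realize (of R ι G f i ∘ v) (of R ι G f i ∘ x) ↔ φ.Realize v x := by
    intro α n φ
    induction φ with
    | falsum => intros; rfl
    | equal t₁ t₂ =>
      intro i v x
      have h : ∀ t : (moduleLanguage R).Term (α ⊕ Fin _),
          t.realize (Sum.elim (of R ι G f i ∘ v) (of R ι G f i ∘ x)) =
            of R ι G f i (t.realize (Sum.elim v x)) := by
        intro t
        rw [← Sum.comp_elim]
        exact FirstOrder.Language.HomClass.realize_term (of R ι G f i).toLanguageHom
      simp only [FirstOrder.Language.BoundedFormula.Realize, h]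
      exact (hinj i).eq_iff
    | rel r => exact Empty.elim r
    | imp _ _ ih ih' =>
      intro i v x
      simp only [FirstOrder.Language.BoundedFormula.Realize, ih i, ih' i]
    | all φ ih =>
      intro i v x
      simp only [FirstOrder.Language.BoundedFormula.Realize]
      constructor
      · intro h a
        rw [← ih, Fin.comp_snoc]
        exact h _
      · intro h a
        obtain ⟨j, b, rfl⟩ := exists_of a
        obtain ⟨k, hik, hjk⟩ := exists_ge_ge i j
        obtain ⟨g, hg⟩ := hf i k hik
        have h1 : ∀ {β : Type} (w : β → G i), of R ι G f i ∘ w = of R ι G f k ∘ (f i k hik ∘ w) := by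
          intro β w
          ext l
          simp
        have h2 := (g.map_boundedFormula φ.all v x).2 h (f j k hjk b)
        rw [hg, ← ih, Fin.comp_snoc] at h2
        rw [h1 v, h1 x]
        simpa using h2
  refine ⟨⟨of R ι G f i, fun n φ x => ?_⟩, rfl⟩
  rw [FirstOrder.Language.Formula.Realize, FirstOrder.Language.Formula.Realize, ← key φ i x default]
  exact iff_of_eq (congrArg _ (Subsingleton.elim _ _))

/-- A system has finitely many unknowns, so its witnesses and `x` all live at one stage `m`;
injectivity brings the equations back to that stage. -/
theorem Module.DirectLimit.isPure_of (hinj : ∀ i j h, Function.Injective (f i j h))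
    (hf : ∀ i j h, (f i j h).IsPure) (i : ι) : (Module.DirectLimit.of R ι G f i).IsPure := by
  classical
  rintro φ x ⟨y, hy⟩
  have hex : ∀ j, ∃ k, ∃ z : G k, of R ι G f k z = y j := fun j => exists_of (y j)
  choose k z hz using hex
  obtain ⟨m, hm⟩ := (Finset.univ.image k ∪ {i}).exists_le
  have him : i ≤ m := hm i (by simp)
  have hkm : ∀ j, k j ≤ m := fun j => hm (k j) (by simp)
  refine hf i m him φ x ⟨fun j => f (k j) m (hkm j) (z j), fun l => ?_⟩
  apply Module.DirectLimit.of_injective_of_injective hinj m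
  simpa [hz] using hy l

end Chain

/-! ### The module of Ulm length at most one -/

section Construction

variable (R : Type u) [Ring R]

/-- An ultrafilter on the finite sets of high formulas that contains all upward cones. -/
noncomputable def highUltrafilter : Ultrafilter (Finset {ψ : UnaryPP R // ψ.IsHigh}) :=
  Ultrafilter.of atTop

theorem eventually_mem_highUltrafilter (ψ : {ψ : UnaryPP R // ψ.IsHigh}) :
    ∀ᶠ F in (highUltrafilter R : Filter (Finset {ψ : UnaryPP R // ψ.IsHigh})), ψ ∈ F := by
  refine Ultrafilter.of_le _ ?_
  filter_upwards [eventually_ge_atTop {ψ}] with F hF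
  exact hF (Finset.mem_singleton_self ψ)

/-- The ultrapower of `M` along `highUltrafilter R`. -/
abbrev HighUltrapower (M : Type v) : Type (max u v) :=
  Germ (highUltrafilter R : Filter (Finset {ψ : UnaryPP R // ψ.IsHigh})) M

/-- Over `ulm R M`, high formulas have witnesses in the first Ulm submodule of the ultrapower. -/
theorem exists_witness_mem_ulm_ultrapower {M : Type v} [AddCommGroup M] [Module R M] {x : M}
    (hx : x ∈ ulm R M) {φ : UnaryPP R} (hφ : φ.IsHigh) :
    ∃ y : Fin φ.k → HighUltrapower R M,
      (∀ j, y j ∈ ulm R (HighUltrapower R M)) ∧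
      ∀ i, ∑ j, φ.A i j • y j = φ.b i •
        Germ.diagonal R M (highUltrafilter R : Filter (Finset {ψ : UnaryPP R // ψ.IsHigh})) x := by
  classical
  have h : ∀ F : Finset {ψ : UnaryPP R // ψ.IsHigh}, ∃ y : Fin φ.k → M,
      (∀ i, ∑ j, φ.A i j • y j = φ.b i • x) ∧ ∀ ψ ∈ F, ∀ j, y j ∈ ψ.1.eval M := by
    intro F
    have hF : ∀ ψ ∈ F.image Subtype.val, ψ.IsHigh := by
      intro ψ hψ
      obtain ⟨ψ', _, rfl⟩ := Finset.mem_image.1 hψ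
      exact ψ'.2
    obtain ⟨y, hy, hyF⟩ := UnaryPP.mem_relativize_eval.1 (hx _ (hφ.relativize hF))
    exact ⟨y, hy, fun ψ hψ j => hyF ψ.1 (Finset.mem_image_of_mem _ hψ) j⟩
  -- One tuple for each `F`; the germs of these families are the required witnesses.
  choose y hy hyF using h
  refine ⟨fun j => ((fun F => y F j : _ → M) : HighUltrapower R M), fun j ψ hψ => ?_, fun i => ?_⟩
  · refine Germ.mem_eval ?_
    filter_upwards [eventually_mem_highUltrafilter R ⟨ψ, hψ⟩] with F hF
    exact hyF F ⟨ψ, hψ⟩ hF j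
  · have hsum : ∑ j, φ.A i j • ((fun F => y F j : _ → M) : HighUltrapower R M) =
        ((∑ j, φ.A i j • (fun F => y F j) : _ → M) : HighUltrapower R M) :=
      (map_sum (Germ.coeAddHom _) (fun j => φ.A i j • (fun F => y F j : _ → M)) Finset.univ).symm
    rw [hsum]
    refine Germ.coe_eq.2 (Eventually.of_forall fun F => ?_)
    simpa using hy F i

/-- If `ulm R (ulm R N)` is all of `ulm R N`, then `N` has Ulm length at most one. -/
theorem ulmLength_le_one {N : Type v} [AddCommGroup N] [Module R N]
    (h : ∀ x ∈ ulm R N, ∀ φ : UnaryPP R, φ.IsHigh → ∃ y : Fin φ.k → N,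
      (∀ j, y j ∈ ulm R N) ∧ ∀ i, ∑ j, φ.A i j • y j = φ.b i • x) :
    ulmLength R N ≤ 1 := by
  have h1 : ulmSeq R N (1 : Ordinal.{v}) = ulm R N := by
    rw [← zero_add (1 : Ordinal.{v}), ulmSeq_add_one, ulmSeq_zero]
    -- `ulmSeq R N 1` is computed inside `⊤` as a submodule, so membership is transported between
    -- `⊤` and `N`.
    refine le_antisymm ?_ fun x hx => ?_
    · rintro _ ⟨x, hx, rfl⟩
      exact LinearMap.map_mem_ulm (Submodule.subtype ⊤) hx
    · exact ⟨⟨x, trivial⟩,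
        LinearMap.map_mem_ulm (Submodule.topEquiv (R := R) (M := N)).symm.toLinearMap hx, rfl⟩
  refine csInf_le' (show ulmSeq R N ((1 : Ordinal.{v}) + 1) = ulmSeq R N 1 from ?_)
  rw [ulmSeq_add_one, h1]
  refine le_antisymm (Submodule.map_subtype_le _ _) fun x hx => ⟨⟨x, hx⟩, fun φ hφ => ?_, rfl⟩
  obtain ⟨y, hyu, hy⟩ := h x hx φ hφ
  refine ⟨fun j => ⟨y j, hyu j⟩, fun i => Subtype.ext ?_⟩
  simpa using hy i

variable (M : Type v) [AddCommGroup M] [Module R M]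

/-- The chain of iterated ultrapowers of `M`. -/
noncomputable def ultrapowerChain : ℕ → ModuleCat.{max u v} R
  -- Lifting puts all stages in the universe `max u v`, where the ultrapowers live.
  | 0 => ModuleCat.of R (ULift.{u} M)
  | n + 1 => ModuleCat.of R (HighUltrapower R (ultrapowerChain n))

/-- The diagonal map between consecutive iterated ultrapowers. -/
noncomputable def ultrapowerChainStep (n : ℕ) :
    ultrapowerChain R M n →ₗ[R] ultrapowerChain R M (n + 1) :=
  Germ.diagonal R (ultrapowerChain R M n)
    (highUltrafilter R : Filter (Finset {ψ : UnaryPP R // ψ.IsHigh}))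

/-- The iterated diagonal maps between the iterated ultrapowers of `M`. -/
noncomputable def ultrapowerChainMap (i j : ℕ) (h : i ≤ j) :
    ultrapowerChain R M i →ₗ[R] ultrapowerChain R M j :=
  Nat.leRecOn (C := fun k => ultrapowerChain R M i →ₗ[R] ultrapowerChain R M k) h
    (fun {k} g => ultrapowerChainStep R M k ∘ₗ g) LinearMap.id

theorem ultrapowerChainMap_self (i : ℕ) : ultrapowerChainMap R M i i le_rfl = LinearMap.id :=
  Nat.leRecOn_self _

theorem ultrapowerChainMap_succ {i j : ℕ} (h : i ≤ j) :
    ultrapowerChainMap R M i (j + 1) (h.trans j.le_succ) =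
      ultrapowerChainStep R M j ∘ₗ ultrapowerChainMap R M i j h :=
  Nat.leRecOn_succ h _

instance ultrapowerChain_directedSystem :
    DirectedSystem (fun i => ultrapowerChain R M i)
      (fun i j h => ultrapowerChainMap R M i j h) where
  map_self := fun i x => by rw [ultrapowerChainMap_self]; rfl
  map_map := fun k j i hij hjk x => by
    induction k, hjk using Nat.le_induction with
    | base => rw [ultrapowerChainMap_self]; rfl
    | succ k hjk ih =>
      rw [ultrapowerChainMap_succ R M hjk, ultrapowerChainMap_succ R M (hij.trans hjk)]
      exact congrArg (ultrapowerChainStep R M k) ih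

theorem isElementary_ultrapowerChainMap (i j : ℕ) (h : i ≤ j) :
    (ultrapowerChainMap R M i j h).IsElementary := by
  induction j, h using Nat.le_induction with
  | base =>
    rw [ultrapowerChainMap_self]
    exact (LinearEquiv.refl R (ultrapowerChain R M i)).isElementary
  | succ j h ih =>
    rw [ultrapowerChainMap_succ R M h]
    exact LinearMap.IsElementary.comp (Germ.isElementary_diagonal (highUltrafilter R)) ih

theorem isPure_ultrapowerChainMap (i j : ℕ) (h : i ≤ j) :
    (ultrapowerChainMap R M i j h).IsPure := by
  induction j, h using Nat.le_induction with
  | base =>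
    rw [ultrapowerChainMap_self]
    exact fun _ _ hx => hx
  | succ j h ih =>
    rw [ultrapowerChainMap_succ R M h]
    exact fun φ x hx => ih φ x (Germ.isPure_diagonal _ φ _ hx)

/-- The union of the chain of iterated ultrapowers of `M`. -/
abbrev UltrapowerLimit : Type (max u v) :=
  Module.DirectLimit (fun i => ultrapowerChain R M i) (ultrapowerChainMap R M)

theorem ulmLength_ultrapowerLimit_le_one : ulmLength R (UltrapowerLimit R M) ≤ 1 := by
  refine ulmLength_le_one R fun x hx φ hφ => ?_
  obtain ⟨n, x, rfl⟩ := Module.DirectLimit.exists_of x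
  have hpure := Module.DirectLimit.isPure_of
    (fun i j h => (isElementary_ultrapowerChainMap R M i j h).injective)
    (isPure_ultrapowerChainMap R M) n
  obtain ⟨y, hyu, hy⟩ := exists_witness_mem_ulm_ultrapower R
    (fun ψ hψ => hpure ψ x (hx ψ hψ) : x ∈ ulm R (ultrapowerChain R M n)) hφ
  -- Stage `n + 1` is by definition the ultrapower of stage `n`, so the witnesses found there map to
  -- the limit.
  let g : HighUltrapower R (ultrapowerChain R M n) →ₗ[R] UltrapowerLimit R M :=
    Module.DirectLimit.of R ℕ (fun i => ultrapowerChain R M i) (ultrapowerChainMap R M) (n + 1)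
  refine ⟨fun j => g (y j), fun j => LinearMap.map_mem_ulm g (hyu j), fun i => ?_⟩
  have hg : Module.DirectLimit.of R ℕ (fun i => ultrapowerChain R M i) (ultrapowerChainMap R M) n x
      = g (ultrapowerChainStep R M n x) := by
    rw [← Module.DirectLimit.of_f (hij := n.le_succ), ultrapowerChainMap_succ R M le_rfl,
      ultrapowerChainMap_self]
    rfl
  rw [hg]
  refine Eq.trans ?_ ((congrArg g (hy i)).trans (map_smul g _ _))
  refine ((map_sum g _ _).trans ?_).symm
  exact Finset.sum_congr rfl fun j _ => map_smul g _ _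

theorem exists_isElementary_ultrapowerLimit :
    ∃ g : M →ₗ[R] UltrapowerLimit R M, g.IsElementary :=
  ⟨_, (Module.DirectLimit.isElementary_of (isElementary_ultrapowerChainMap R M) 0).comp
    (ULift.moduleEquiv.{u, v, u} (R := R) (M := M)).symm.isElementary⟩

end Construction

theorem mainTheorem7 (R : Type u) [Ring R] (M : Type v) [AddCommGroup M] [Module R M] :
    ∃ (N : Type (max u v)) (_ : AddCommGroup N) (_ : Module R N),
      ulmLength R N ≤ 1 ∧
      (M ≅[moduleLanguage R] N) ∧
      ∃ S : Submodule R N, S.IsElementary ∧ Nonempty (M ≃ₗ[R] S) := by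
  obtain ⟨g, hg⟩ := exists_isElementary_ultrapowerLimit R M
  let e : M ≃ₗ[R] LinearMap.range g := LinearEquiv.ofInjective g hg.injective
  refine ⟨UltrapowerLimit R M, inferInstance, inferInstance,
    ulmLength_ultrapowerLimit_le_one R M, ?_, LinearMap.range g, ?_, ⟨e⟩⟩
  · obtain ⟨g', _⟩ := hg
    exact g'.elementarilyEquivalent
  · obtain ⟨h, hh⟩ := hg.comp e.symm.isElementary
    refine ⟨h, fun x => ?_⟩
    rw [hh]
    exact congrArg Subtype.val (e.apply_symm_apply x)
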